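/- Let $K$ be an algebraically closed field, let $n\ge 0$ and $d\ge 1$ be integers, and assume that $\operatorname{char}(K)$ is $0$ or greater than $d(d-1)$. Let $f\in K[x_1,\dots,x_n,y]$ be an irreducible polynomial of total degree $d$ satisfying Hypothesis (H): (1) $f$ is monic as a polynomial in $y$ and $\deg_y(f)=\deg(f)$; (2) the resultant of $f(0,\dots,0,y)$ and $\frac{\partial f}{\partial y}(0,\dots,0,y)$ is nonzero. Call $a=(a_1,\dots,a_n)\in K^n$ a Bertinian good point for $f$ if for every irreducible factor $\tilde f$ of $f$ over $K$ the bivariate polynomial $\tilde f(a_1x,\dots,a_nx,y)\in K[x,y]$ is irreducible over $K$, and a Bertinian bad point for $f$ otherwise. Let $m=2^{d-1}-1$. Then there exist nonzero polynomials $Q_1,\dots,Q_m\in K[z_1,\dots,z_n]$ of degree at most $2d-1$ such that for every Bertinian bad point $a\in K^n$ for $f$, at least one $Q_i$ vanishes at $a$. -/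

import Mathlib

namespace BertinianCover

open MvPolynomial

/-- Polynomials over `K` in the variables `x₁, …, xₙ, y`: the variable `y` is the one with index
`none`, and `xᵢ` is the one with index `some i`. -/
abbrev PolyXY (n : ℕ) (K : Type*) [CommSemiring K] : Type _ :=
  MvPolynomial (Option (Fin n)) K

variable {n : ℕ} {K : Type*} [Field K]

/-- The univariate polynomial `f(0, …, 0, y) ∈ K[y]`. -/
noncomputable def atZero (f : PolyXY n K) : Polynomial K :=
  aeval (fun o : Option (Fin n) => o.elim Polynomial.X (fun _ => 0)) f

/-- The bivariate polynomial `f(a₁ x, …, aₙ x, y) ∈ K[x][y]`. -/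
noncomputable def restrict (f : PolyXY n K) (a : Fin n → K) : Polynomial (Polynomial K) :=
  aeval (fun o : Option (Fin n) =>
    o.elim Polynomial.X (fun i => Polynomial.C (Polynomial.C (a i) * Polynomial.X))) f

/-- Hypothesis (H) for a non-constant polynomial `f ∈ K[x₁, …, xₙ, y]`. -/
structure HypothesisH (f : PolyXY n K) : Prop where
  /-- `f` is monic as a polynomial in `y` with coefficients in `K[x₁, …, xₙ]`. -/
  monic : (optionEquivLeft K (Fin n) f).Monic
  /-- The degree of `f` in `y` is the total degree of `f`. -/
  degree_y : degreeOf none f = f.totalDegree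
  /-- The resultant of `f(0, y)` and `(∂f/∂y)(0, y)` does not vanish. -/
  resultant_ne_zero : Polynomial.resultant (atZero f) (atZero (pderiv none f)) ≠ 0

/-- `a` is a Bertinian good point for `f` if `g(a₁ x, …, aₙ x, y)` is irreducible in `K[x, y]` for
every irreducible factor `g` of `f`. -/
def BertinianGood (f : PolyXY n K) (a : Fin n → K) : Prop :=
  ∀ g : PolyXY n K, Irreducible g → g ∣ f → Irreducible (restrict g a)

/-- `a` is a Bertinian bad point for `f` if it is not a Bertinian good point for `f`. -/
def BertinianBad (f : PolyXY n K) (a : Fin n → K) : Prop :=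
  ¬ BertinianGood f a

end BertinianCover

/-! Along the generic line `x = z X`, Hypothesis (H) and Newton iteration split `f` as `F = ∏ (Y - φ
i)`. The `φ i` are power series in `X` with distinct constant terms, and their coefficient of `X ^
k` is homogeneous of degree `k` in `z`. At a bad point `a` the specialized polynomial factors as `P
* Q`, where `P` collects the roots in a proper set `T`, which may be assumed to contain `0`. Total
degrees then bound `Q ∂P/∂Y` by `d - 1` and `Q X ∂P/∂X` by `d`, so every coefficient of `logDerivY φ
T` and `logDerivX φ T` beyond these bounds vanishes at `a` (`exists_finset_forall_eval_eq_zero`).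
There are `2 ^ (d - 1) - 1` such sets `T`, and one nonzero coefficient is chosen for each.

Such a coefficient exists with `k < 2 d` (`exists_coeff_ne_zero`). Otherwise the truncations `G`,
`H` modulo `X ^ (2 d)` obey the degree bounds, and the closedness relation between the two
logarithmic derivatives, known modulo `X ^ (2 d)`, holds exactly because its total degree is below
`2 d`. Hence `G / F_Y` has zero derivative at each root of `F`. At a root outside `T` its constant
term is zero, so the characteristic assumption makes `G` vanish there through order `d (d - 1)`.
This exceeds what a nonzero norm of `G` allows (`coeff_prod_eval_eq_zero`), so `G` shares a root
with the irreducible `F` while having smaller `Y`-degree. Thus `G = 0`, contradicting its nonzero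
values at the roots in `T`. -/

namespace BertinianCover

open Polynomial
open scoped Differential PowerSeries

/-! ### Total degree, `X`-adic order and the Euler derivation. -/

section PowerSeriesPolynomials

variable {R : Type*} [CommRing R]

/-- The Euler derivation `X d/dX` on power series. -/
noncomputable instance eulerDifferential : Differential R⟦X⟧ where
  deriv := @Derivation.mk ℤ R⟦X⟧ R⟦X⟧ _ _ _ (Ring.toIntAlgebra R⟦X⟧) _ _
    ((PowerSeries.X : R⟦X⟧) •
      PowerSeries.derivative R).toLinearMap.toAddMonoidHom.toIntLinearMap
    ((PowerSeries.X : R⟦X⟧) • PowerSeries.derivative R).map_one_eq_zero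
    ((PowerSeries.X : R⟦X⟧) • PowerSeries.derivative R).leibniz

lemma coeff_euler (s : R⟦X⟧) (k : ℕ) :
    PowerSeries.coeff k s′ = k * PowerSeries.coeff k s := by
  change PowerSeries.coeff k (PowerSeries.X * PowerSeries.derivative R s) = _
  cases k with
  | zero => simp
  | succ k => rw [PowerSeries.coeff_succ_X_mul, PowerSeries.coeff_derivative]; push_cast; ring

/-- The total degree of `P ∈ R⟦X⟧[Y]` in `X` and `Y` is at most `N`. -/
def WeightLE (N : ℕ) (P : R⟦X⟧[X]) : Prop :=
  ∀ j k, N < j + k → PowerSeries.coeff k (P.coeff j) = 0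

/-- All coefficients of `P ∈ R⟦X⟧[Y]` are divisible by `X ^ N`. -/
def OrderGE (N : ℕ) (P : R⟦X⟧[X]) : Prop :=
  ∀ j k, k < N → PowerSeries.coeff k (P.coeff j) = 0

namespace WeightLE

variable {M N : ℕ} {P Q : R⟦X⟧[X]}

lemma mono (h : WeightLE M P) (hMN : M ≤ N) : WeightLE N P :=
  fun j k hjk => h j k (by omega)

lemma sub (hP : WeightLE N P) (hQ : WeightLE N Q) : WeightLE N (P - Q) := fun j k h => by
  simp [hP j k h, hQ j k h]

lemma mul (hP : WeightLE M P) (hQ : WeightLE N Q) : WeightLE (M + N) (P * Q) := fun j k h => by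
  rw [Polynomial.coeff_mul, map_sum]
  refine Finset.sum_eq_zero fun x hx => ?_
  rw [PowerSeries.coeff_mul]
  refine Finset.sum_eq_zero fun y hy => ?_
  rw [Finset.HasAntidiagonal.mem_antidiagonal] at hx hy
  by_cases h1 : M < x.1 + y.1
  · rw [hP _ _ h1, zero_mul]
  · rw [hQ _ _ (by omega), mul_zero]

lemma derivative (hP : WeightLE (N + 1) P) : WeightLE N (derivative P) := fun j k h => by
  rw [coeff_derivative]
  have hk := hP (j + 1) k (by omega)
  rw [PowerSeries.coeff_mul]
  refine Finset.sum_eq_zero fun y hy => ?_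
  rw [Finset.HasAntidiagonal.mem_antidiagonal] at hy
  rcases Nat.eq_zero_or_pos y.2 with h0 | h0
  · have : y.1 = k := by omega
    rw [this, hk, zero_mul]
  · have : PowerSeries.coeff y.2 ((j : R⟦X⟧) + 1) = 0 := by
      have e : ((j : R⟦X⟧) + 1) = PowerSeries.C ((j : R) + 1) := by simp
      rw [e, PowerSeries.coeff_C, if_neg (by omega)]
    rw [this, mul_zero]

lemma mapCoeffs (hP : WeightLE N P) : WeightLE N (Differential.mapCoeffs P) := fun j k h => by
  rw [Differential.coeff_mapCoeffs, coeff_euler, hP j k h, mul_zero]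

lemma X_mul (hP : WeightLE N P) : WeightLE (N + 1) (X * P) := fun j k h => by
  cases j with
  | zero => simp
  | succ j => rw [coeff_X_mul]; exact hP j k (by omega)

end WeightLE

namespace OrderGE

variable {N : ℕ} {P Q : R⟦X⟧[X]}

lemma sub (hP : OrderGE N P) (hQ : OrderGE N Q) : OrderGE N (P - Q) := fun j k h => by
  simp [hP j k h, hQ j k h]

lemma mul_left (hP : OrderGE N P) (Q : R⟦X⟧[X]) : OrderGE N (Q * P) := fun j k h => by
  rw [Polynomial.coeff_mul, map_sum]
  refine Finset.sum_eq_zero fun x hx => ?_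
  rw [PowerSeries.coeff_mul]
  refine Finset.sum_eq_zero fun y hy => ?_
  rw [Finset.HasAntidiagonal.mem_antidiagonal] at hx hy
  rw [hP _ _ (by omega), mul_zero]

lemma derivative (hP : OrderGE N P) : OrderGE N (derivative P) := fun j k h => by
  rw [coeff_derivative, PowerSeries.coeff_mul]
  refine Finset.sum_eq_zero fun y hy => ?_
  rw [Finset.HasAntidiagonal.mem_antidiagonal] at hy
  rw [hP _ _ (by omega), zero_mul]

lemma mapCoeffs (hP : OrderGE N P) : OrderGE N (Differential.mapCoeffs P) := fun j k h => by
  rw [Differential.coeff_mapCoeffs, coeff_euler, hP j k h, mul_zero]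

lemma eval (hP : OrderGE N P) (s : R⟦X⟧) {k : ℕ} (hk : k < N) :
    PowerSeries.coeff k (P.eval s) = 0 := by
  rw [eval_eq_sum_range, map_sum]
  refine Finset.sum_eq_zero fun x _ => ?_
  rw [PowerSeries.coeff_mul]
  refine Finset.sum_eq_zero fun y hy => ?_
  rw [Finset.HasAntidiagonal.mem_antidiagonal] at hy
  rw [hP _ _ (by omega), zero_mul]

lemma eq_zero (hP : OrderGE N P) {M : ℕ} (hP' : WeightLE M P) (h : M < N) : P = 0 := by
  ext j k
  by_cases hk : k < N
  · simpa using hP j k hk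
  · simpa using hP' j k (by omega)

end OrderGE

/-- In degree `k`, once the lower coefficients of `w` vanish, the left side is `k u₀ w_k` and the
right side is zero, because `u′` has no constant term. Only the integers up to `B` have to be
nonzero in `R`. -/
lemma coeff_eq_zero_of_mul_euler_eq [IsDomain R] {u w : R⟦X⟧} (h : u * w′ = w * u′)
    (hu : PowerSeries.coeff 0 u ≠ 0) (hw : PowerSeries.coeff 0 w = 0) {B : ℕ}
    (hB : ∀ k : ℕ, 0 < k → k ≤ B → (k : R) ≠ 0) (k : ℕ) (hk : k ≤ B) :
    PowerSeries.coeff k w = 0 := by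
  induction k using Nat.strong_induction_on with
  | _ k ih =>
  rcases Nat.eq_zero_or_pos k with rfl | hpos
  · exact hw
  have h1 : PowerSeries.coeff k (u * w′) =
      PowerSeries.coeff 0 u * ((k : R) * PowerSeries.coeff k w) := by
    rw [PowerSeries.coeff_mul, Finset.sum_eq_single (0, k)]
    · rw [coeff_euler]
    · rintro ⟨a, b⟩ hab hne
      rw [Finset.HasAntidiagonal.mem_antidiagonal] at hab
      have : b ≠ k := by rintro rfl; apply hne; simp at hab; simp [hab]
      rw [coeff_euler, ih b (by simp at hab; omega) (by simp at hab; omega), mul_zero, mul_zero]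
    · simp
  have h2 : PowerSeries.coeff k (w * u′) = 0 := by
    rw [PowerSeries.coeff_mul]
    refine Finset.sum_eq_zero fun ⟨a, b⟩ hab => ?_
    rw [Finset.HasAntidiagonal.mem_antidiagonal] at hab
    simp only at hab ⊢
    rw [coeff_euler]
    by_cases ha : a = k
    · have : b = 0 := by omega
      simp [this]
    · rw [ih a (by omega) (by omega), zero_mul]
  rw [h, h2] at h1
  rcases mul_eq_zero.1 h1.symm with h | h
  · exact absurd h hu
  · exact (mul_eq_zero.1 h).resolve_left (hB k hpos hk)

/-- If `F E(G) - G E(F) = F H' - H F'` then, at a root of `F`, the quotient `G / F'` is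
annihilated by the derivation. -/
lemma wronskian_eval_root {S : Type*} [CommRing S] [IsDomain S] [Differential S] {F G H : S[X]}
    (h : F * Differential.mapCoeffs G - G * Differential.mapCoeffs F =
      F * derivative H - H * derivative F) {s : S} (hs : F.eval s = 0)
    (hs' : (derivative F).eval s ≠ 0) :
    (derivative F).eval s * (G.eval s)′ = G.eval s * ((derivative F).eval s)′ := by
  have ev (P : S[X]) : (P.eval s)′ =
      (Differential.mapCoeffs P).eval s + (derivative P).eval s * s′ := by
    simpa using Differential.deriv_aeval_eq (A := S) s P
  have comm (P : S[X]) : derivative (Differential.mapCoeffs P) =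
      Differential.mapCoeffs (derivative P) := by
    ext j
    simp [coeff_derivative, mul_comm]
  -- At `s` the identity gives `H(s) = -G(s) s′`; its `Y`-derivative at `s` then gives the claim.
  have h0 := congr_arg (Polynomial.eval s) h
  have h1 := congr_arg (fun P => Polynomial.eval s (derivative P)) h
  have hF := ev F
  rw [hs, map_zero] at hF
  rw [ev G, ev (derivative F)]
  simp only [eval_sub, eval_mul, derivative_sub, derivative_mul, eval_add, hs, comm] at h0 h1
  generalize Polynomial.eval s (Differential.mapCoeffs F) = EF at *
  generalize Polynomial.eval s (Differential.mapCoeffs G) = EG at *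
  generalize Polynomial.eval s (Differential.mapCoeffs (derivative F)) = EF' at *
  generalize Polynomial.eval s (Differential.mapCoeffs (derivative G)) = EG' at *
  generalize Polynomial.eval s (derivative F) = F1 at *
  generalize Polynomial.eval s (derivative (derivative F)) = F2 at *
  generalize Polynomial.eval s (derivative G) = G1 at *
  generalize Polynomial.eval s (derivative H) = H1 at *
  generalize Polynomial.eval s (derivative (derivative H)) = H2 at *
  generalize Polynomial.eval s G = g at *
  generalize Polynomial.eval s H = hh at *
  have hEF : EF = -(F1 * s′) := by linear_combination -hF
  have hH : hh = -(g * s′) := by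
    apply mul_right_cancel₀ hs'
    rw [hEF] at h0
    linear_combination h0
  rw [hEF, hH] at h1
  linear_combination h1

/-- Formally divided by `(P Q) ^ 2`, this is the equality of mixed derivatives of `log P` with
respect to `Y` and the derivation of `S`. -/
lemma wronskian_factor {S : Type*} [CommRing S] [Differential S] (P Q : S[X]) :
    (P * Q) * Differential.mapCoeffs (derivative P * Q) -
        (derivative P * Q) * Differential.mapCoeffs (P * Q) =
      (P * Q) * derivative (Differential.mapCoeffs P * Q) -
        (Differential.mapCoeffs P * Q) * derivative (P * Q) := by
  have comm : derivative (Differential.mapCoeffs P) =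
      Differential.mapCoeffs (derivative P) := by
    ext j
    simp [coeff_derivative, mul_comm]
  simp only [Derivation.leibniz, derivative_mul, comm, smul_eq_mul]
  ring

end PowerSeriesPolynomials

/-! ### Logarithmic derivatives of partial products of roots. -/

section PartialFactors

variable {R : Type*} [CommRing R] {d : ℕ}

/-- `F / P * ∂P/∂Y`, where `F` is the monic polynomial with roots `φ i` and `P` its monic factor
with roots `φ i`, `i ∈ T`. -/
noncomputable def logDerivY (φ : Fin d → R⟦X⟧) (T : Finset (Fin d)) : R⟦X⟧[X] :=
  derivative (Lagrange.nodal T φ) * Lagrange.nodal Tᶜ φ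

/-- `F / P * X ∂P/∂X`, where `F` is the monic polynomial with roots `φ i` and `P` its monic factor
with roots `φ i`, `i ∈ T`. -/
noncomputable def logDerivX (φ : Fin d → R⟦X⟧) (T : Finset (Fin d)) : R⟦X⟧[X] :=
  Differential.mapCoeffs (Lagrange.nodal T φ) * Lagrange.nodal Tᶜ φ

lemma nodal_mul_nodal_compl (φ : Fin d → R⟦X⟧) (T : Finset (Fin d)) :
    Lagrange.nodal T φ * Lagrange.nodal Tᶜ φ = Lagrange.nodal Finset.univ φ :=
  Finset.prod_mul_prod_compl T _

lemma eval_logDerivY_of_notMem (φ : Fin d → R⟦X⟧) {T : Finset (Fin d)} {l : Fin d} (hl : l ∉ T) :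
    (logDerivY φ T).eval (φ l) = 0 := by
  rw [logDerivY, eval_mul, Lagrange.eval_nodal_at_node (by simpa using hl), mul_zero]

variable [IsDomain R]

lemma constantCoeff_eval_derivative_nodal_ne_zero {φ : Fin d → R⟦X⟧}
    (hφ : Function.Injective fun i => PowerSeries.constantCoeff (φ i)) (l : Fin d) :
    PowerSeries.constantCoeff ((derivative (Lagrange.nodal Finset.univ φ)).eval (φ l)) ≠ 0 := by
  rw [Lagrange.eval_nodal_derivative_eval_node_eq (Finset.mem_univ l), Lagrange.eval_nodal,
    map_prod]
  refine Finset.prod_ne_zero_iff.2 fun j hj => ?_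
  rw [map_sub, sub_ne_zero]
  exact fun h => (Finset.ne_of_mem_erase hj) (hφ h).symm

/-- At a root indexed by `T`, the other term of the product rule for `F` vanishes, so the value is
that of `∂F/∂Y`. -/
lemma constantCoeff_eval_logDerivY_ne_zero {φ : Fin d → R⟦X⟧}
    (hφ : Function.Injective fun i => PowerSeries.constantCoeff (φ i)) {T : Finset (Fin d)}
    {l : Fin d} (hl : l ∈ T) :
    PowerSeries.constantCoeff ((logDerivY φ T).eval (φ l)) ≠ 0 := by
  have h := constantCoeff_eval_derivative_nodal_ne_zero hφ l
  rw [← nodal_mul_nodal_compl φ T, derivative_mul, eval_add, eval_mul (p := Lagrange.nodal T φ),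
    Lagrange.eval_nodal_at_node hl, zero_mul, add_zero] at h
  exact h

end PartialFactors

/-! ### The norm modulo `F`, and the vanishing argument. -/

section Norm

variable {R : Type*} [CommRing R]

/-- A representative of `Y ^ i * G` modulo the monic polynomial `F` of degree `e + 1`. -/
noncomputable def mulRem (e : ℕ) (F G : R⟦X⟧[X]) : ℕ → R⟦X⟧[X]
  | 0 => G
  | i + 1 => X * mulRem e F G i - C ((mulRem e F G i).coeff e) * F

lemma natDegree_mulRem_le {e : ℕ} {F G : R⟦X⟧[X]} (hF : F.Monic) (hFd : F.natDegree = e + 1)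
    (hG : G.natDegree ≤ e) (i : ℕ) : (mulRem e F G i).natDegree ≤ e := by
  induction i with
  | zero => exact hG
  | succ i ih =>
    rw [natDegree_le_iff_coeff_eq_zero] at ih ⊢
    intro N hN
    obtain ⟨N, rfl⟩ : ∃ M, N = M + 1 := ⟨N - 1, by omega⟩
    rw [mulRem, coeff_sub, coeff_X_mul, coeff_C_mul]
    rcases Nat.lt_or_ge e N with h | h
    · rw [ih N h, coeff_eq_zero_of_natDegree_lt (p := F) (by omega), mul_zero, sub_zero]
    · obtain rfl : e = N := by omega
      rw [← hFd, hF.coeff_natDegree, mul_one, sub_self]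

lemma weightLE_mulRem {e : ℕ} {F G : R⟦X⟧[X]} (hF : WeightLE (e + 1) F) (hG : WeightLE e G)
    (i : ℕ) : WeightLE (e + i) (mulRem e F G i) := by
  induction i with
  | zero => exact hG
  | succ i ih =>
    have hC : WeightLE i (C ((mulRem e F G i).coeff e)) := fun j k h => by
      rw [coeff_C]
      split_ifs with hj
      · exact ih e k (by omega)
      · simp
    exact ih.X_mul.sub ((hC.mul hF).mono (by omega))

lemma eval_mulRem {e : ℕ} {F G : R⟦X⟧[X]} {s : R⟦X⟧} (hs : F.eval s = 0) (i : ℕ) :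
    (mulRem e F G i).eval s = s ^ i * G.eval s := by
  induction i with
  | zero => simp [mulRem]
  | succ i ih => simp [mulRem, hs, ih]; ring

lemma coeff_prod_eq_zero_of_lt {ι : Type*} (s : Finset ι) (a b : ι → ℕ) (p : ι → R⟦X⟧)
    (h : ∀ i ∈ s, ∀ k, a i < k + b i → PowerSeries.coeff k (p i) = 0) (k : ℕ)
    (hk : ∑ i ∈ s, a i < k + ∑ i ∈ s, b i) : PowerSeries.coeff k (∏ i ∈ s, p i) = 0 := by
  classical
  induction s using Finset.induction_on generalizing k with
  | empty =>
    have : k ≠ 0 := by simp at hk; omega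
    simp [PowerSeries.coeff_one, this]
  | insert i s hi ih =>
    rw [Finset.sum_insert hi, Finset.sum_insert hi] at hk
    rw [Finset.prod_insert hi, PowerSeries.coeff_mul]
    refine Finset.sum_eq_zero fun x hx => ?_
    rw [Finset.HasAntidiagonal.mem_antidiagonal] at hx
    by_cases h1 : a i < x.1 + b i
    · rw [h i (by simp) _ h1, zero_mul]
    · rw [ih (fun j hj => h j (by simp [hj])) x.2 (by omega), mul_zero]

/-- The norm of a polynomial of total degree at most `d - 1` modulo a polynomial of total degree
`d` which is monic in `Y` has degree at most `d (d - 1)`. -/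
lemma coeff_prod_eval_eq_zero [IsDomain R] {e : ℕ} {φ : Fin (e + 1) → R⟦X⟧}
    (hφ : Function.Injective φ) (hF : WeightLE (e + 1) (Lagrange.nodal Finset.univ φ))
    {G : R⟦X⟧[X]} (hGd : G.natDegree ≤ e) (hG : WeightLE e G) {k : ℕ} (hk : (e + 1) * e < k) :
    PowerSeries.coeff k (∏ i, G.eval (φ i)) = 0 := by
  set F := Lagrange.nodal Finset.univ φ with hFdef
  have hFm : F.Monic := Lagrange.nodal_monic
  have hFd : F.natDegree = e + 1 := by simp [hFdef, Lagrange.natDegree_nodal]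
  -- `M` is multiplication by `G` modulo `F` in the basis `Y ^ i`. The Vandermonde matrix
  -- diagonalizes it, so its determinant is the norm.
  let M : Matrix (Fin (e + 1)) (Fin (e + 1)) R⟦X⟧ := fun i j => (mulRem e F G i).coeff j
  have hMV : M * (Matrix.vandermonde φ).transpose =
      (Matrix.vandermonde φ).transpose * Matrix.diagonal fun l => G.eval (φ l) := by
    ext1 i l
    have h0 : F.eval (φ l) = 0 := Lagrange.eval_nodal_at_node (Finset.mem_univ l)
    rw [Matrix.mul_diagonal, Matrix.mul_apply]
    simp only [Matrix.transpose_apply, Matrix.vandermonde_apply]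
    rw [← eval_mulRem (e := e) h0 i, eval_eq_sum_range' (n := e + 1)
      (Nat.lt_succ_of_le (natDegree_mulRem_le hFm hFd hGd i)), Finset.sum_range]
  have hdet := congr_arg Matrix.det hMV
  rw [Matrix.det_mul, Matrix.det_mul, Matrix.det_diagonal, mul_comm] at hdet
  rw [← mul_left_cancel₀ (by
    rw [Matrix.det_transpose]; exact Matrix.det_vandermonde_ne_zero_iff.2 hφ) hdet,
    Matrix.det_apply, map_sum]
  refine Finset.sum_eq_zero fun σ _ => ?_
  have hprod : PowerSeries.coeff k (∏ i, M (σ i) i) = 0 := by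
    -- Entry `(i, j)` has degree at most `e + i - j`; over a permutation the index terms cancel,
    -- leaving `(e + 1) * e`.
    refine coeff_prod_eq_zero_of_lt _ (fun i => e + (σ i : ℕ)) (fun i => (i : ℕ)) _
      (fun i _ k hk => weightLE_mulRem hF hG _ _ _ (by omega)) k ?_
    rw [Finset.sum_add_distrib, Equiv.sum_comp σ (fun i : Fin (e + 1) => (i : ℕ))]
    simp only [Finset.sum_const, Finset.card_univ, Fintype.card_fin, smul_eq_mul]
    omega
  rcases Int.units_eq_one_or (Equiv.Perm.sign σ) with h | h <;> simp [h, hprod]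

/-- Approximations of `logDerivY φ T` and `logDerivX φ T` modulo `X ^ (2 d)` by polynomials of small
total degree force the former to vanish at some root. -/
lemma exists_eval_eq_zero_of_approx [IsDomain R] {e : ℕ} {φ : Fin (e + 1) → R⟦X⟧}
    (hφ : Function.Injective fun i => PowerSeries.constantCoeff (φ i))
    (hF : WeightLE (e + 1) (Lagrange.nodal Finset.univ φ))
    (hB : ∀ k : ℕ, 0 < k → k ≤ (e + 1) * e → (k : R) ≠ 0)
    {T : Finset (Fin (e + 1))} (hT : T ≠ Finset.univ) {G H : R⟦X⟧[X]} (hGd : G.natDegree ≤ e)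
    (hG : WeightLE e G) (hH : WeightLE (e + 1) H)
    (hGT : OrderGE (2 * (e + 1)) (G - logDerivY φ T))
    (hHT : OrderGE (2 * (e + 1)) (H - logDerivX φ T)) :
    ∃ l, G.eval (φ l) = 0 := by
  obtain ⟨l, hl⟩ : ∃ l, l ∉ T := by simpa [Finset.eq_univ_iff_forall] using hT
  set F := Lagrange.nodal Finset.univ φ with hFdef
  have hfac := wronskian_factor (Lagrange.nodal T φ) (Lagrange.nodal Tᶜ φ)
  rw [nodal_mul_nodal_compl φ T, ← hFdef, ← logDerivY, ← logDerivX] at hfac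
  have hA := eval_logDerivY_of_notMem φ hl
  generalize logDerivY φ T = A at *
  generalize logDerivX φ T = B at *
  have hW : F * Differential.mapCoeffs G - G * Differential.mapCoeffs F =
      F * derivative H - H * derivative F := by
    rw [← sub_eq_zero]
    -- Each product has total degree at most `(e + 1) + e`, one less than the precision; this is the
    -- source of the bound `2 d - 1`.
    refine OrderGE.eq_zero (N := 2 * (e + 1)) ?_ (M := 2 * e + 1) ?_ (by omega)
    · have key : F * Differential.mapCoeffs G - G * Differential.mapCoeffs F -
          (F * derivative H - H * derivative F) =
          (F * Differential.mapCoeffs (G - A) - Differential.mapCoeffs F * (G - A)) -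
            (F * derivative (H - B) - derivative F * (H - B)) := by
        rw [map_sub, derivative_sub]
        linear_combination hfac
      rw [key]
      exact ((hGT.mapCoeffs.mul_left F).sub (hGT.mul_left _)).sub
        ((hHT.derivative.mul_left F).sub (hHT.mul_left _))
    · refine WeightLE.sub (WeightLE.sub ?_ ?_) (WeightLE.sub ?_ ?_)
      · exact (hF.mul hG.mapCoeffs).mono (by omega)
      · exact (hG.mul hF.mapCoeffs).mono (by omega)
      · exact (hF.mul hH.derivative).mono (by omega)
      · exact (hH.mul hF.derivative).mono (by omega)
  have hu := constantCoeff_eval_derivative_nodal_ne_zero hφ l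
  rw [← hFdef, ← PowerSeries.coeff_zero_eq_constantCoeff_apply] at hu
  have hk := wronskian_eval_root hW (Lagrange.eval_nodal_at_node (Finset.mem_univ l))
    (fun h => hu (by simp [h]))
  have hw0 : PowerSeries.coeff 0 (G.eval (φ l)) = 0 := by
    have := hGT.eval (φ l) (k := 0) (by omega)
    rwa [eval_sub, hA, sub_zero] at this
  have hw := coeff_eq_zero_of_mul_euler_eq hk hu hw0 hB
  have hφ' : Function.Injective φ := fun i j h => hφ (by simp [h])
  have hprod : ∏ i, G.eval (φ i) = 0 := by
    ext k
    rw [map_zero]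
    by_cases hk : (e + 1) * e < k
    · exact coeff_prod_eval_eq_zero hφ' hF hGd hG hk
    · rw [← Finset.mul_prod_erase _ _ (Finset.mem_univ l), PowerSeries.coeff_mul]
      refine Finset.sum_eq_zero fun x hx => ?_
      rw [Finset.HasAntidiagonal.mem_antidiagonal] at hx
      rw [hw _ (by omega), zero_mul]
  obtain ⟨i, -, hi⟩ := Finset.prod_eq_zero_iff.1 hprod
  exact ⟨i, hi⟩

end Norm

/-! ### Series on the generic line, and descent to `K[x]`. -/

section HomogeneousSeries

variable (σ K : Type*) [CommRing K]

/-- Power series in one variable over `K[z]` whose coefficient of degree `k` is homogeneous of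
degree `k` in `z`. -/
def homogSeries : Subring (MvPolynomial σ K)⟦X⟧ where
  carrier := {s | ∀ k, (PowerSeries.coeff k s).IsHomogeneous k}
  mul_mem' {a b} ha hb k := by
    rw [PowerSeries.coeff_mul]
    refine MvPolynomial.IsHomogeneous.sum _ _ _ fun x hx => ?_
    rw [Finset.HasAntidiagonal.mem_antidiagonal] at hx
    rw [← hx]
    exact (ha _).mul (hb _)
  one_mem' k := by
    rw [PowerSeries.coeff_one]
    split_ifs with h
    · rw [h]; exact MvPolynomial.isHomogeneous_one _ _
    · exact MvPolynomial.isHomogeneous_zero _ _ _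
  add_mem' {a b} ha hb k := by rw [map_add]; exact (ha k).add (hb k)
  zero_mem' k := by rw [map_zero]; exact MvPolynomial.isHomogeneous_zero _ _ _
  neg_mem' {a} ha k := by rw [map_neg]; exact (ha k).neg

variable {σ K}

lemma C_C_mem_homogSeries (r : K) : PowerSeries.C (MvPolynomial.C r) ∈ homogSeries σ K := by
  intro k
  rw [PowerSeries.coeff_C]
  split_ifs with h
  · rw [h]; exact MvPolynomial.isHomogeneous_C _ _
  · exact MvPolynomial.isHomogeneous_zero _ _ _

/-- The embedding `p(x) ↦ p(z₁ X, …, zₙ X)` of `K[x]` into `K[z]⟦X⟧`. -/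
noncomputable def generalLine : MvPolynomial σ K →+* (MvPolynomial σ K)⟦X⟧ :=
  MvPolynomial.eval₂Hom (PowerSeries.C.comp MvPolynomial.C)
    fun i => PowerSeries.C (MvPolynomial.X i) * PowerSeries.X

lemma coeff_generalLine (p : MvPolynomial σ K) (k : ℕ) :
    PowerSeries.coeff k (generalLine p) = MvPolynomial.homogeneousComponent k p := by
  induction p using MvPolynomial.induction_on' with
  | add p q hp hq => simp only [map_add, hp, hq]
  | monomial m r =>
    have h : generalLine (MvPolynomial.monomial m r) =
        PowerSeries.C (MvPolynomial.monomial m r) * PowerSeries.X ^ m.degree := by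
      rw [generalLine, MvPolynomial.coe_eval₂Hom, MvPolynomial.eval₂_monomial]
      simp only [mul_pow, Finsupp.prod, Finset.prod_mul_distrib, Finset.prod_pow_eq_pow_sum,
        RingHom.comp_apply]
      rw [← mul_assoc, Finsupp.degree, MvPolynomial.monomial_eq, Finsupp.prod, map_mul, map_prod]
      simp only [map_pow]
      rfl
    rw [h, PowerSeries.coeff_C_mul, PowerSeries.coeff_X_pow]
    have hm : MvPolynomial.monomial m r ∈ MvPolynomial.homogeneousSubmodule σ K m.degree :=
      MvPolynomial.isHomogeneous_monomial r rfl
    rw [MvPolynomial.homogeneousComponent_of_mem hm]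
    split_ifs <;> simp

lemma generalLine_mem (p : MvPolynomial σ K) : generalLine p ∈ homogSeries σ K := fun k => by
  rw [coeff_generalLine]
  exact MvPolynomial.homogeneousComponent_isHomogeneous k p

lemma generalLine_injective : Function.Injective (generalLine (σ := σ) (K := K)) := by
  intro p q h
  rw [← MvPolynomial.sum_homogeneousComponent p, ← MvPolynomial.sum_homogeneousComponent q]
  have hc : ∀ k, MvPolynomial.homogeneousComponent k p = MvPolynomial.homogeneousComponent k q :=
    fun k => by rw [← coeff_generalLine, h, coeff_generalLine]
  have hext (p : MvPolynomial σ K) {N : ℕ} (hN : p.totalDegree + 1 ≤ N) :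
      ∑ i ∈ Finset.range (p.totalDegree + 1), MvPolynomial.homogeneousComponent i p =
        ∑ i ∈ Finset.range N, MvPolynomial.homogeneousComponent i p := by
    refine Finset.sum_subset (by simpa using hN) fun i _ hi => ?_
    exact MvPolynomial.homogeneousComponent_eq_zero _ _ (by simp at hi; omega)
  rw [hext p (le_max_left _ (q.totalDegree + 1)), hext q (le_max_right (p.totalDegree + 1) _)]
  simp only [hc]

lemma constantCoeff_generalLine (p : MvPolynomial σ K) :
    PowerSeries.constantCoeff (generalLine p) =
      MvPolynomial.C (MvPolynomial.constantCoeff p) := by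
  rw [← PowerSeries.coeff_zero_eq_constantCoeff_apply, coeff_generalLine,
    MvPolynomial.homogeneousComponent_zero]
  rfl

lemma coeff_generalLine_eq_zero {p : MvPolynomial σ K} {k : ℕ} (h : p.totalDegree < k) :
    PowerSeries.coeff k (generalLine p) = 0 := by
  rw [coeff_generalLine, MvPolynomial.homogeneousComponent_eq_zero _ _ h]

/-- The polynomial over `K[x]` obtained from `P ∈ K[z]⟦X⟧[Y]` by truncating the coefficients at
`X ^ N` and setting `X = 1`. -/
noncomputable def truncToPoly (N : ℕ) (P : (MvPolynomial σ K)⟦X⟧[X]) : (MvPolynomial σ K)[X] :=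
  ∑ j ∈ Finset.range (P.natDegree + 1),
    monomial j (∑ k ∈ Finset.range N, PowerSeries.coeff k (P.coeff j))

lemma coeff_truncToPoly (N : ℕ) (P : (MvPolynomial σ K)⟦X⟧[X]) (j : ℕ) :
    (truncToPoly N P).coeff j = ∑ k ∈ Finset.range N, PowerSeries.coeff k (P.coeff j) := by
  rw [truncToPoly, finsetSum_coeff]
  simp only [coeff_monomial]
  rw [Finset.sum_ite_eq']
  split_ifs with h
  · rfl
  · rw [coeff_eq_zero_of_natDegree_lt (by simpa using h)]; simp

/-- Setting `X = 1` loses nothing: by homogeneity, the coefficient of `X ^ k` is recovered as the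
component of degree `k`. -/
lemma coeff_generalLine_truncToPoly {N : ℕ} {P : (MvPolynomial σ K)⟦X⟧[X]}
    (hP : ∀ j, P.coeff j ∈ homogSeries σ K) (j k : ℕ) :
    PowerSeries.coeff k (((truncToPoly N P).map generalLine).coeff j) =
      if k < N then PowerSeries.coeff k (P.coeff j) else 0 := by
  rw [coeff_map, coeff_generalLine, coeff_truncToPoly, map_sum,
    Finset.sum_congr rfl fun i _ => MvPolynomial.homogeneousComponent_of_mem
      (show PowerSeries.coeff i (P.coeff j) ∈ MvPolynomial.homogeneousSubmodule σ K i from hP j i),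
    Finset.sum_ite_eq]
  simp only [Finset.mem_range]

end HomogeneousSeries

/-! ### Power series roots by Newton iteration. -/

section Newton

variable {R : Type*} [CommRing R]

lemma eval_mem_of_coeff_mem {S : Type*} [CommRing S] {A : Subring S} {P : S[X]}
    (hP : ∀ j, P.coeff j ∈ A) {a : S} (ha : a ∈ A) : P.eval a ∈ A := by
  rw [eval_eq_sum_range]
  exact A.sum_mem fun j _ => A.mul_mem (hP j) (A.pow_mem ha j)

/-- Newton iteration with constant slope. -/
lemma exists_root_approx (A : Subring R⟦X⟧) {P : R⟦X⟧[X]} (hP : ∀ j, P.coeff j ∈ A)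
    {a c : R⟦X⟧} (ha : a ∈ A) (hc : c ∈ A) (h0 : PowerSeries.X ∣ P.eval a)
    (h1 : PowerSeries.X ∣ 1 - c * (derivative P).eval a) :
    ∃ s : R⟦X⟧, P.eval s = 0 ∧ PowerSeries.X ∣ s - a ∧
      ∀ k : ℕ, ∃ b ∈ A, PowerSeries.X ^ (k + 1) ∣ s - b := by
  let u : ℕ → R⟦X⟧ := fun k => Nat.rec a (fun _ b => b - c * P.eval b) k
  have hu0 : u 0 = a := rfl
  have hu (k : ℕ) : u (k + 1) = u k - c * P.eval (u k) := rfl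
  have key (k : ℕ) : u k ∈ A ∧ PowerSeries.X ∣ u k - a ∧
      PowerSeries.X ^ (k + 1) ∣ P.eval (u k) := by
    induction k with
    | zero => simpa [hu0] using ⟨ha, h0⟩
    | succ k ih =>
      obtain ⟨hA, ⟨v, hv⟩, ⟨w, hw⟩⟩ := ih
      refine ⟨A.sub_mem hA (A.mul_mem hc (eval_mem_of_coeff_mem hP hA)), ?_, ?_⟩
      · rw [hu, hw]
        exact ⟨v - c * PowerSeries.X ^ k * w, by linear_combination hv⟩
      · obtain ⟨q, hq⟩ := P.binomExpansion (u k) (-(c * P.eval (u k)))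
        obtain ⟨r, hr⟩ := h1
        obtain ⟨t, ht⟩ := sub_dvd_eval_sub (u k) a (derivative P)
        rw [hu, sub_eq_add_neg, hq, hw]
        refine ⟨w * (r - c * v * t) + q * c ^ 2 * PowerSeries.X ^ k * w ^ 2, ?_⟩
        rw [hv] at ht
        linear_combination PowerSeries.X ^ (k + 1) * w * hr -
          PowerSeries.X ^ (k + 1) * w * c * ht
  have hstep (k i : ℕ) (hi : i ≤ k) :
      PowerSeries.coeff i (u (k + 1)) = PowerSeries.coeff i (u k) := by
    obtain ⟨w, hw⟩ := (key k).2.2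
    rw [hu, hw, map_sub, mul_left_comm, PowerSeries.coeff_X_pow_mul', if_neg (by omega), sub_zero]
  have hstab (k i : ℕ) (hi : i ≤ k) : PowerSeries.coeff i (u k) = PowerSeries.coeff i (u i) := by
    induction k, hi using Nat.le_induction with
    | base => rfl
    | succ k hik ih => rw [hstep k i hik, ih]
  let s : R⟦X⟧ := PowerSeries.mk fun i => PowerSeries.coeff i (u i)
  have hs (k : ℕ) : PowerSeries.X ^ (k + 1) ∣ s - u k := by
    rw [PowerSeries.X_pow_dvd_iff]
    intro i hi
    rw [map_sub, PowerSeries.coeff_mk, hstab k i (by omega), sub_self]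
  refine ⟨s, ?_, ?_, fun k => ⟨u k, (key k).1, hs k⟩⟩
  · ext k
    have h2 : PowerSeries.X ^ (k + 1) ∣ P.eval s := by
      have := dvd_add ((hs k).trans (sub_dvd_eval_sub s (u k) P)) (key k).2.2
      rwa [sub_add_cancel] at this
    rw [map_zero]
    exact PowerSeries.X_pow_dvd_iff.1 h2 k (by omega)
  · simpa [hu0] using hs 0

lemma exists_homogSeries_root {σ K : Type*} [Field K] {P : (MvPolynomial σ K)⟦X⟧[X]}
    (hP : ∀ j, P.coeff j ∈ homogSeries σ K) {p : K[X]}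
    (hPp : P.map PowerSeries.constantCoeff = p.map MvPolynomial.C) {r : K} (hr : p.eval r = 0)
    (hr' : (derivative p).eval r ≠ 0) :
    ∃ s ∈ homogSeries σ K, P.eval s = 0 ∧ PowerSeries.constantCoeff s = MvPolynomial.C r := by
  have hev (Q : (MvPolynomial σ K)⟦X⟧[X]) (q : K[X])
      (h : Q.map PowerSeries.constantCoeff = q.map MvPolynomial.C) :
      PowerSeries.constantCoeff (Q.eval (PowerSeries.C (MvPolynomial.C r))) =
        MvPolynomial.C (q.eval r) := by
    rw [← eval_map_apply, h, PowerSeries.constantCoeff_C, eval_map_apply]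
  obtain ⟨s, hs, hsa, hsk⟩ := exists_root_approx (homogSeries σ K) hP
    (C_C_mem_homogSeries r) (C_C_mem_homogSeries (((derivative p).eval r)⁻¹))
    (PowerSeries.X_dvd_iff.2 (by rw [hev P p hPp, hr, map_zero]))
    (PowerSeries.X_dvd_iff.2 (by
      rw [map_sub, map_mul, map_one, PowerSeries.constantCoeff_C, hev (derivative P) (derivative p)
        (by rw [← derivative_map, hPp, derivative_map]), ← map_mul,
        inv_mul_cancel₀ hr', map_one, sub_self]))
  refine ⟨s, fun k => ?_, hs, ?_⟩
  · obtain ⟨b, hb, h⟩ := hsk k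
    have := PowerSeries.X_pow_dvd_iff.1 h k (by omega)
    rw [map_sub, sub_eq_zero] at this
    rw [this]
    exact hb k
  · rw [PowerSeries.X_dvd_iff, map_sub, sub_eq_zero, PowerSeries.constantCoeff_C] at hsa
    exact hsa

end Newton

/-- Over an integrally closed domain the minimal polynomial of `s` divides every polynomial
vanishing at `s`; irreducibility makes it an associate of `F`. -/
lemma eval_map_ne_zero_of_natDegree_lt {A S : Type*} [CommRing A] [IsDomain A]
    [IsIntegrallyClosed A] [CommRing S] [IsDomain S] {ψ : A →+* S} (hψ : Function.Injective ψ)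
    {F g : A[X]} (hF : F.Monic) (hirr : Irreducible F) {s : S} (hs : (F.map ψ).eval s = 0)
    (hg : g ≠ 0) (hgF : g.natDegree < F.natDegree) : (g.map ψ).eval s ≠ 0 := by
  let := ψ.toAlgebra
  have : FaithfulSMul A S := (faithfulSMul_iff_algebraMap_injective A S).2 hψ
  have : Module.IsTorsionFree A S := inferInstance
  intro hgs
  have hFs : aeval s F = 0 := by rwa [aeval_def, eval₂_eq_eval_map]
  have hgs' : aeval s g = 0 := by rwa [aeval_def, eval₂_eq_eval_map]
  have hint : IsIntegral A s := ⟨F, hF, by rwa [← aeval_def]⟩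
  have h1 : F ∣ minpoly A s := by
    rcases hirr.dvd_iff.1 (minpoly.isIntegrallyClosed_dvd hint hFs) with h | h
    · exact absurd h (minpoly.not_isUnit A s)
    · exact h.dvd
  have := natDegree_le_of_dvd (h1.trans (minpoly.isIntegrallyClosed_dvd hint hgs')) hg
  omega

/-! ### A nonzero coefficient for each subset of roots. -/

section Certificate

variable {K : Type*} [Field K] {n e : ℕ}

lemma coeff_logDeriv_mem {φ : Fin (e + 1) → (MvPolynomial (Fin n) K)⟦X⟧}
    (hφ : ∀ i, φ i ∈ homogSeries (Fin n) K) (T : Finset (Fin (e + 1))) :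
    (∀ j, (logDerivY φ T).coeff j ∈ homogSeries (Fin n) K) ∧
      ∀ j, (logDerivX φ T).coeff j ∈ homogSeries (Fin n) K := by
  have hmul {P Q : (MvPolynomial (Fin n) K)⟦X⟧[X]} (hP : ∀ j, P.coeff j ∈ homogSeries (Fin n) K)
      (hQ : ∀ j, Q.coeff j ∈ homogSeries (Fin n) K) (j : ℕ) :
      (P * Q).coeff j ∈ homogSeries (Fin n) K := by
    rw [Polynomial.coeff_mul]
    exact Subring.sum_mem _ fun x _ => Subring.mul_mem _ (hP _) (hQ _)
  have hnod (T : Finset (Fin (e + 1))) (j : ℕ) :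
      (Lagrange.nodal T φ).coeff j ∈ homogSeries (Fin n) K := by
    rw [Lagrange.nodal]
    induction T using Finset.induction_on generalizing j with
    | empty =>
      rw [Finset.prod_empty, coeff_one]
      split_ifs
      · exact one_mem _
      · exact zero_mem _
    | insert i T hi ih =>
      rw [Finset.prod_insert hi]
      refine hmul (fun j => ?_) ih j
      rw [coeff_sub, coeff_X, coeff_C]
      refine sub_mem ?_ ?_
      · split_ifs
        · exact one_mem _
        · exact zero_mem _
      · split_ifs
        · exact hφ i
        · exact zero_mem _
  refine ⟨hmul (fun j => ?_) (hnod _), hmul (fun j => ?_) (hnod _)⟩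
  · rw [coeff_derivative]
    exact mul_mem (hnod _ _) (by exact_mod_cast natCast_mem (homogSeries (Fin n) K) (j + 1))
  · intro k
    -- Unlike `d/dX`, the Euler derivation only rescales each coefficient, so homogeneity of degree
    -- `k` survives.
    rw [Differential.coeff_mapCoeffs, coeff_euler, ← nsmul_eq_mul]
    exact Submodule.smul_of_tower_mem (MvPolynomial.homogeneousSubmodule (Fin n) K k) k
      (hnod T j k)

/-- Among the coefficients of `logDerivY φ T` and `logDerivX φ T` which vanish along every line
where the factor with roots `φ i`, `i ∈ T`, is a polynomial, one of degree at most `2 e + 1` does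
not vanish identically. -/
lemma exists_coeff_ne_zero {F : (MvPolynomial (Fin n) K)[X]} (hF : F.Monic)
    (hirr : Irreducible F) (hFd : F.natDegree = e + 1) (hFw : WeightLE (e + 1) (F.map generalLine))
    {φ : Fin (e + 1) → (MvPolynomial (Fin n) K)⟦X⟧} (hφ : ∀ i, φ i ∈ homogSeries (Fin n) K)
    (hinj : Function.Injective fun i => PowerSeries.constantCoeff (φ i))
    (hFφ : F.map generalLine = Lagrange.nodal Finset.univ φ)
    (hB : ∀ k : ℕ, 0 < k → k ≤ (e + 1) * e → (k : K) ≠ 0) {T : Finset (Fin (e + 1))}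
    (hT : T ≠ Finset.univ) (hT' : T.Nonempty) :
    ∃ q : MvPolynomial (Fin n) K, q ≠ 0 ∧ q.totalDegree ≤ 2 * e + 1 ∧
      ((∃ j k, e < j + k ∧ q = PowerSeries.coeff k ((logDerivY φ T).coeff j)) ∨
        ∃ j k, e + 1 < j + k ∧ q = PowerSeries.coeff k ((logDerivX φ T).coeff j)) := by
  obtain ⟨hY, hX⟩ := coeff_logDeriv_mem hφ T
  by_contra! hcon
  have hdeg {q : MvPolynomial (Fin n) K} {k : ℕ} (hq : q.IsHomogeneous k) (hk : k < 2 * (e + 1)) :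
      q.totalDegree ≤ 2 * e + 1 := hq.totalDegree_le.trans (by omega)
  have hY0 (j k : ℕ) (hk : k < 2 * (e + 1)) (hjk : e < j + k) :
      PowerSeries.coeff k ((logDerivY φ T).coeff j) = 0 := by
    by_contra h
    exact (hcon _ h (hdeg (hY j k) hk)).1 j k hjk rfl
  have hX0 (j k : ℕ) (hk : k < 2 * (e + 1)) (hjk : e + 1 < j + k) :
      PowerSeries.coeff k ((logDerivX φ T).coeff j) = 0 := by
    by_contra h
    exact (hcon _ h (hdeg (hX j k) hk)).2 j k hjk rfl
  set g := truncToPoly (2 * (e + 1)) (logDerivY φ T) with hg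
  set h := truncToPoly (2 * (e + 1)) (logDerivX φ T) with hh
  have hGT : OrderGE (2 * (e + 1)) (g.map generalLine - logDerivY φ T) := fun j k hk => by
    rw [coeff_sub, map_sub, hg, coeff_generalLine_truncToPoly hY, if_pos hk, sub_self]
  have hHT : OrderGE (2 * (e + 1)) (h.map generalLine - logDerivX φ T) := fun j k hk => by
    rw [coeff_sub, map_sub, hh, coeff_generalLine_truncToPoly hX, if_pos hk, sub_self]
  have hGw : WeightLE e (g.map generalLine) := fun j k hjk => by
    rw [hg, coeff_generalLine_truncToPoly hY]
    split_ifs with hk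
    · exact hY0 j k hk hjk
    · rfl
  have hHw : WeightLE (e + 1) (h.map generalLine) := fun j k hjk => by
    rw [hh, coeff_generalLine_truncToPoly hX]
    split_ifs with hk
    · exact hX0 j k hk hjk
    · rfl
  have hgd : g.natDegree ≤ e := by
    rw [natDegree_le_iff_coeff_eq_zero]
    intro j hj
    apply generalLine_injective
    ext1 k
    rw [← coeff_map, hGw j k (by omega), map_zero, map_zero]
  obtain ⟨l, hl⟩ := exists_eval_eq_zero_of_approx hinj (hFφ ▸ hFw)
    (fun k h0 hk h => hB k h0 hk (by
      apply MvPolynomial.C_injective (Fin n) K; simpa using h)) hT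
    (natDegree_map_le.trans hgd) hGw hHw hGT hHT
  refine eval_map_ne_zero_of_natDegree_lt generalLine_injective hF hirr (s := φ l) (g := g)
    ?_ ?_ (by omega) hl
  · rw [hFφ]
    exact Lagrange.eval_nodal_at_node (Finset.mem_univ l)
  · intro hg0
    obtain ⟨i, hi⟩ := hT'
    have h1 := constantCoeff_eval_logDerivY_ne_zero hinj hi
    have h2 := hGT.eval (φ i) (k := 0) (by omega)
    rw [hg0, Polynomial.map_zero, zero_sub, eval_neg, map_neg, neg_eq_zero,
      PowerSeries.coeff_zero_eq_constantCoeff_apply] at h2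
    exact h1 h2

end Certificate

/-! ### Total degree of the factors of a monic polynomial. -/

section WeightOfFactors

variable {K : Type*} [Field K]

/-- The substitution `p(X, Y) ↦ p(X T, Y T)`. -/
noncomputable def scaleVars : K[X][X] →+* K[X][X][X] :=
  eval₂RingHom (S := K[X][X][X]) (eval₂RingHom (S := K[X][X][X])
    (C.comp (C.comp C)) (C (C X) * X)) (C X * X)

lemma scaleVars_monomial (j k : ℕ) (r : K) :
    scaleVars (monomial j (monomial k r)) = monomial (j + k) (monomial j (monomial k r)) := by
  simp only [scaleVars, coe_eval₂RingHom, eval₂_monomial, RingHom.comp_apply]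
  simp only [← C_mul_X_pow_eq_monomial, map_mul, map_pow]
  ring

lemma coeff_scaleVars (p : K[X][X]) (N j k : ℕ) :
    (((scaleVars p).coeff N).coeff j).coeff k = if j + k = N then (p.coeff j).coeff k else 0 := by
  induction p using Polynomial.induction_on' with
  | add p q hp hq => simp only [map_add, coeff_add, hp, hq]; split_ifs <;> simp
  | monomial i s =>
    induction s using Polynomial.induction_on' with
    | add s t hs ht => simp only [map_add, coeff_add, hs, ht]; split_ifs <;> simp
    | monomial l r =>
      rw [scaleVars_monomial, coeff_monomial]
      split_ifs <;> simp only [coeff_monomial, coeff_zero] <;> split_ifs <;>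
        simp only [coeff_monomial, coeff_zero] <;> grind

lemma natDegree_scaleVars_le_iff {p : K[X][X]} {N : ℕ} :
    (scaleVars p).natDegree ≤ N ↔ WeightLE N (p.map coeToPowerSeries.ringHom) := by
  have hc (j k : ℕ) : PowerSeries.coeff k ((p.map coeToPowerSeries.ringHom).coeff j) =
      (p.coeff j).coeff k := by
    rw [coeff_map, coeToPowerSeries.ringHom_apply, coeff_coe]
  rw [natDegree_le_iff_coeff_eq_zero]
  constructor
  · intro h j k hjk
    have := coeff_scaleVars p (j + k) j k
    rw [h _ hjk, if_pos rfl] at this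
    rw [hc, ← this, coeff_zero, coeff_zero]
  · intro h M hM
    ext j k
    rw [coeff_scaleVars, coeff_zero, coeff_zero]
    split_ifs with hjk
    · rw [← hc, h j k (by omega)]
    · rfl

lemma natDegree_le_natDegree_scaleVars {p : K[X][X]} (hp : p.Monic) :
    p.natDegree ≤ (scaleVars p).natDegree := by
  apply le_natDegree_of_ne_zero
  intro h
  have := coeff_scaleVars p p.natDegree p.natDegree 0
  rw [h, hp.coeff_natDegree] at this
  simp at this

/-- The degree in the scaling variable is additive and, for a monic polynomial, at least the
`Y`-degree; the bound on the product leaves no slack in either factor. -/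
lemma weightLE_of_mul {p q : K[X][X]} (hp : p.Monic) (hq : q.Monic)
    (h : WeightLE (p.natDegree + q.natDegree) ((p * q).map coeToPowerSeries.ringHom)) :
    WeightLE p.natDegree (p.map coeToPowerSeries.ringHom) ∧
      WeightLE q.natDegree (q.map coeToPowerSeries.ringHom) := by
  rw [← natDegree_scaleVars_le_iff, map_mul] at h
  have h1 := natDegree_le_natDegree_scaleVars hp
  have h2 := natDegree_le_natDegree_scaleVars hq
  have hne {p : K[X][X]} (hp : p.Monic) : scaleVars p ≠ 0 := by
    intro h
    have := coeff_scaleVars p p.natDegree p.natDegree 0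
    rw [h, hp.coeff_natDegree] at this
    simp at this
  rw [natDegree_mul (hne hp) (hne hq)] at h
  rw [← natDegree_scaleVars_le_iff, ← natDegree_scaleVars_le_iff]
  omega

end WeightOfFactors

/-! ### Monic factors of a product of distinct linear factors. -/

section Nodal

variable {S : Type*} [CommRing S] [IsDomain S] {d : ℕ} {ψ : Fin d → S}

lemma eq_nodal_of_monic (hψ : Function.Injective ψ) {p : S[X]} (hp : p.Monic)
    {T : Finset (Fin d)} (hpT : p.natDegree = T.card) (h : ∀ i ∈ T, p.eval (ψ i) = 0) :
    p = Lagrange.nodal T ψ := by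
  refine Polynomial.eq_of_degree_sub_lt_of_eval_index_eq T hψ.injOn ?_ fun i hi => by
    rw [h i hi, Lagrange.eval_nodal_at_node hi]
  have h1 : p.degree = (Lagrange.nodal T ψ).degree := by
    rw [Lagrange.degree_nodal, degree_eq_natDegree hp.ne_zero, hpT]
  have := degree_sub_lt_left h1 hp.ne_zero (by
    rw [hp.leadingCoeff, (Lagrange.nodal_monic (s := T) (v := ψ)).leadingCoeff])
  rwa [degree_eq_natDegree hp.ne_zero, hpT] at this

lemma card_le_natDegree_of_eval_eq_zero (hψ : Function.Injective ψ) {p : S[X]} (hp : p ≠ 0)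
    {T : Finset (Fin d)} (h : ∀ i ∈ T, p.eval (ψ i) = 0) : T.card ≤ p.natDegree := by
  classical
  rw [← Finset.card_image_of_injective T hψ]
  refine (Finset.card_le_card (t := p.roots.toFinset) fun x hx => ?_).trans
    ((Multiset.toFinset_card_le _).trans (card_roots' p))
  obtain ⟨i, hi, rfl⟩ := Finset.mem_image.1 hx
  simpa [hp] using h i hi

lemma exists_eq_nodal_of_mul_eq (hψ : Function.Injective ψ) {p q : S[X]} (hp : p.Monic)
    (hq : q.Monic) (h : p * q = Lagrange.nodal Finset.univ ψ) :
    ∃ T : Finset (Fin d), p = Lagrange.nodal T ψ ∧ q = Lagrange.nodal Tᶜ ψ := by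
  classical
  let T : Finset (Fin d) := {i | p.eval (ψ i) = 0}
  let U : Finset (Fin d) := {i | q.eval (ψ i) = 0}
  have hT : T.card ≤ p.natDegree :=
    card_le_natDegree_of_eval_eq_zero hψ hp.ne_zero fun i hi => by simpa [T] using hi
  have hU : U.card ≤ q.natDegree :=
    card_le_natDegree_of_eval_eq_zero hψ hq.ne_zero fun i hi => by simpa [U] using hi
  have hTU : Tᶜ ⊆ U := fun i hi => by
    have h0 : (p * q).eval (ψ i) = 0 := by
      rw [h, Lagrange.eval_nodal_at_node (Finset.mem_univ i)]
    rw [eval_mul, mul_eq_zero] at h0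
    simp only [T, U, Finset.compl_filter, Finset.mem_filter, Finset.mem_univ, true_and] at hi ⊢
    exact h0.resolve_left hi
  have hd : p.natDegree + q.natDegree = d := by
    rw [← hp.natDegree_mul hq, h, Lagrange.natDegree_nodal, Finset.card_univ, Fintype.card_fin]
  have hc := Finset.card_le_card hTU
  have hc' : T.card + Tᶜ.card = d := by
    rw [Finset.card_add_card_compl, Fintype.card_fin]
  exact ⟨T, eq_nodal_of_monic hψ hp (by omega) fun i hi => by simpa [T] using hi,
    eq_nodal_of_monic hψ hq (by omega) fun i hi => by simpa [U] using hTU hi⟩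

end Nodal

/-! ### Specialization of the line and reducibility. -/

section Specialization

variable {R K : Type*} [CommRing R] [Field K] {e : ℕ}

lemma map_nodal {S S' : Type*} [CommRing S] [CommRing S'] (g : S →+* S') {d : ℕ} (φ : Fin d → S)
    (T : Finset (Fin d)) :
    (Lagrange.nodal T φ).map g = Lagrange.nodal T fun i => g (φ i) := by
  simp [Lagrange.nodal, Polynomial.map_prod]

lemma coeff_logDerivY_map (g : R →+* K) (φ : Fin (e + 1) → R⟦X⟧) (T : Finset (Fin (e + 1)))
    (j k : ℕ) :
    PowerSeries.coeff k ((logDerivY (fun i => PowerSeries.map g (φ i)) T).coeff j) =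
      g (PowerSeries.coeff k ((logDerivY φ T).coeff j)) := by
  rw [← PowerSeries.coeff_map, ← coeff_map, logDerivY, logDerivY, Polynomial.map_mul,
    ← derivative_map, map_nodal, map_nodal]

lemma coeff_logDerivX_map (g : R →+* K) (φ : Fin (e + 1) → R⟦X⟧) (T : Finset (Fin (e + 1)))
    (j k : ℕ) :
    PowerSeries.coeff k ((logDerivX (fun i => PowerSeries.map g (φ i)) T).coeff j) =
      g (PowerSeries.coeff k ((logDerivX φ T).coeff j)) := by
  have h (P : R⟦X⟧[X]) : (Differential.mapCoeffs P).map (PowerSeries.map g) =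
      Differential.mapCoeffs (P.map (PowerSeries.map g)) := by
    ext j k
    simp [coeff_euler]
  rw [← PowerSeries.coeff_map, ← coeff_map, logDerivX, logDerivX, Polynomial.map_mul,
    h, map_nodal, map_nodal]

/-- A monic polynomial in `K[X][Y]` of total degree `e + 1` which is reducible has a proper factor
containing the first root. -/
lemma exists_finset_of_not_irreducible {p : K[X][X]} (hp : p.Monic) (hpd : p.natDegree = e + 1)
    (hpw : WeightLE (e + 1) (p.map coeToPowerSeries.ringHom)) (hirr : ¬ Irreducible p)
    {ψ : Fin (e + 1) → K⟦X⟧} (hψ : Function.Injective ψ)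
    (hpψ : p.map coeToPowerSeries.ringHom = Lagrange.nodal Finset.univ ψ) :
    ∃ T : Finset (Fin (e + 1)), 0 ∈ T ∧ T ≠ Finset.univ ∧ WeightLE e (logDerivY ψ T) ∧
      WeightLE (e + 1) (logDerivX ψ T) := by
  have hp1 : p ≠ 1 := by rintro rfl; simp at hpd
  rw [hp.irreducible_iff_natDegree] at hirr
  push Not at hirr
  obtain ⟨q, r, hq, hr, hqr, hq0, hr0⟩ := hirr hp1
  have hd : q.natDegree + r.natDegree = e + 1 := by rw [← hq.natDegree_mul hr, hqr, hpd]
  obtain ⟨T, hT, hTc⟩ := exists_eq_nodal_of_mul_eq hψ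
    (hq.map coeToPowerSeries.ringHom) (hr.map coeToPowerSeries.ringHom)
    (by rw [← Polynomial.map_mul, hqr, hpψ])
  obtain ⟨hqw, hrw⟩ := weightLE_of_mul hq hr (by rw [hqr, hd]; exact hpw)
  rw [hT] at hqw
  rw [hTc] at hrw
  have hTcard : T.card = q.natDegree := by
    rw [← Lagrange.natDegree_nodal (s := T) (v := ψ), ← hT, hq.natDegree_map]
  have hTcard' : Tᶜ.card = r.natDegree := by
    rw [← Lagrange.natDegree_nodal (s := Tᶜ) (v := ψ), ← hTc, hr.natDegree_map]
  have main {U : Finset (Fin (e + 1))} {a b : ℕ} (ha : a ≠ 0) (hab : a + b = e + 1)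
      (hU : WeightLE a (Lagrange.nodal U ψ)) (hUc : WeightLE b (Lagrange.nodal Uᶜ ψ)) :
      WeightLE e (logDerivY ψ U) ∧ WeightLE (e + 1) (logDerivX ψ U) := by
    obtain ⟨a, rfl⟩ := Nat.exists_eq_succ_of_ne_zero ha
    exact ⟨(hU.derivative.mul hUc).mono (by omega), (hU.mapCoeffs.mul hUc).mono (by omega)⟩
  -- The two factors play symmetric roles, so `T` may be replaced by its complement; this halves the
  -- number of subsets needed.
  by_cases h0 : 0 ∈ T
  · refine ⟨T, h0, ?_, main hq0 hd hqw hrw⟩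
    rintro rfl
    simp at hTcard'
    omega
  · refine ⟨Tᶜ, by simpa using h0, ?_, main (b := q.natDegree) hr0 (by omega) hrw (by rwa [compl_compl])⟩
    intro h
    rw [Finset.compl_eq_univ_iff] at h
    rw [h] at hTcard
    simp at hTcard
    omega

end Specialization

/-! ### Translation from `f` to univariate polynomials over `K[x]`. -/

section Restriction

variable {K : Type*} [Field K] {n : ℕ}

lemma restrict_eq_map (f : PolyXY n K) (a : Fin n → K) :
    restrict f a = (MvPolynomial.optionEquivLeft K (Fin n) f).map
      (MvPolynomial.aeval fun i => C (a i) * X : MvPolynomial (Fin n) K →ₐ[K] K[X]).toRingHom := by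
  induction f using MvPolynomial.induction_on with
  | C r => simp [restrict, MvPolynomial.optionEquivLeft_C]
  | add p q hp hq => simp only [restrict, map_add, Polynomial.map_add] at *; rw [hp, hq]
  | mul_X p i hp =>
    simp only [restrict, map_mul, Polynomial.map_mul] at *
    rw [hp]
    cases i <;> simp [MvPolynomial.optionEquivLeft_X_some, MvPolynomial.optionEquivLeft_X_none]

lemma map_restrict (f : PolyXY n K) (a : Fin n → K) :
    (restrict f a).map coeToPowerSeries.ringHom =
      ((MvPolynomial.optionEquivLeft K (Fin n) f).map generalLine).map
        (PowerSeries.map (MvPolynomial.eval a)) := by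
  rw [restrict_eq_map, Polynomial.map_map, Polynomial.map_map]
  congr 1
  refine MvPolynomial.ringHom_ext (fun r => ?_) fun i => ?_
  · simp [generalLine]
  · simp [generalLine]

lemma atZero_eq_map (f : PolyXY n K) :
    atZero f = (MvPolynomial.optionEquivLeft K (Fin n) f).map MvPolynomial.constantCoeff := by
  induction f using MvPolynomial.induction_on with
  | C r => simp [atZero, MvPolynomial.optionEquivLeft_C]
  | add p q hp hq => simp only [atZero, map_add, Polynomial.map_add] at *; rw [hp, hq]
  | mul_X p i hp =>
    simp only [atZero, map_mul, Polynomial.map_mul] at *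
    rw [hp]
    cases i <;> simp [MvPolynomial.optionEquivLeft_X_some, MvPolynomial.optionEquivLeft_X_none]

lemma atZero_pderiv (f : PolyXY n K) :
    atZero (MvPolynomial.pderiv none f) = derivative (atZero f) := by
  induction f using MvPolynomial.induction_on with
  | C r => simp [atZero]
  | add p q hp hq => simp only [atZero, map_add] at *; rw [hp, hq]
  | mul_X p i hp =>
    simp only [atZero, map_mul, Derivation.leibniz, map_add, smul_eq_mul, derivative_mul] at *
    rw [hp]
    cases i <;> (simp [MvPolynomial.pderiv_X]; try ring)

lemma weightLE_map_generalLine {f : PolyXY n K} {d : ℕ} (hf : f.totalDegree = d)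
    (hy : MvPolynomial.degreeOf none f = d) :
    WeightLE d ((MvPolynomial.optionEquivLeft K (Fin n) f).map generalLine) := fun j k h => by
  rw [coeff_map]
  by_cases hj : j ≤ d
  · have := MvPolynomial.totalDegree_coeff_optionEquivLeft_add_le K _ f j (by omega)
    exact coeff_generalLine_eq_zero (by omega)
  · rw [coeff_eq_zero_of_natDegree_lt (by
      rw [MvPolynomial.natDegree_optionEquivLeft, hy]; omega)]
    simp

lemma exists_roots [IsAlgClosed K] {p : K[X]} (hp : p.Monic) (hres : p.resultant (derivative p) ≠ 0)
    {d : ℕ} (hd : p.natDegree = d) :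
    ∃ α : Fin d → K, Function.Injective α ∧ ∀ i, p.eval (α i) = 0 ∧ (derivative p).eval (α i) ≠ 0 := by
  classical
  have hsep : p.Separable := by
    by_contra h
    exact hres (resultant_eq_zero_iff.2 ⟨Or.inl hp.ne_zero, h⟩)
  have hcard : p.roots.toFinset.card = d := by
    rw [Multiset.toFinset_card_of_nodup (nodup_roots hsep), ← hd]
    exact ((splits_iff_card_roots.1 (IsAlgClosed.splits p)))
  let ε := p.roots.toFinset.equivFinOfCardEq hcard
  have h0 (i : Fin d) : p.eval (ε.symm i : K) = 0 := by
    have := (ε.symm i).2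
    rw [Multiset.mem_toFinset, mem_roots hp.ne_zero] at this
    exact this
  exact ⟨fun i => ε.symm i, Subtype.val_injective.comp ε.symm.injective, fun i =>
    ⟨h0 i, hsep.eval₂_derivative_ne_zero (RingHom.id K) (h0 i)⟩⟩

end Restriction

/-! ### Factorization on the generic line and at bad points. -/

section Cover

variable {K : Type*} [Field K] {n e : ℕ}

lemma not_irreducible_restrict_of_bad {f : PolyXY n K} (hf : Irreducible f) {a : Fin n → K}
    (h : BertinianBad f a) : ¬ Irreducible (restrict f a) := by
  intro hirr
  refine h fun g hg hgf => ?_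
  exact (((hg.dvd_irreducible_iff_associated hf).1 hgf).map
    (MvPolynomial.aeval (fun o : Option (Fin n) => o.elim X fun i => C (C (a i) * X)) :
      PolyXY n K →ₐ[K] K[X][X])).irreducible_iff.2 hirr

lemma exists_factorization [IsAlgClosed K] {f : PolyXY n K} (hH : HypothesisH f)
    (hd : f.totalDegree = e + 1) :
    ∃ φ : Fin (e + 1) → (MvPolynomial (Fin n) K)⟦X⟧,
      (∀ i, φ i ∈ homogSeries (Fin n) K) ∧
      (∃ α : Fin (e + 1) → K, Function.Injective α ∧
        ∀ i, PowerSeries.constantCoeff (φ i) = MvPolynomial.C (α i)) ∧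
      (MvPolynomial.optionEquivLeft K (Fin n) f).map generalLine =
        Lagrange.nodal Finset.univ φ := by
  have hFd : (MvPolynomial.optionEquivLeft K (Fin n) f).natDegree = e + 1 := by
    rw [MvPolynomial.natDegree_optionEquivLeft, hH.degree_y, hd]
  obtain ⟨α, hα, hroot⟩ := exists_roots (p := atZero f) (d := e + 1)
    (by rw [atZero_eq_map]; exact hH.monic.map _)
    (by rw [← atZero_pderiv]; exact hH.resultant_ne_zero)
    (by rw [atZero_eq_map, hH.monic.natDegree_map, hFd])
  have hex (i : Fin (e + 1)) := exists_homogSeries_root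
    (P := (MvPolynomial.optionEquivLeft K (Fin n) f).map generalLine) (p := atZero f)
    (fun j => by rw [coeff_map]; exact generalLine_mem _)
    (by
      rw [atZero_eq_map, Polynomial.map_map, Polynomial.map_map]
      congr 1
      exact RingHom.ext constantCoeff_generalLine) (hroot i).1 (hroot i).2
  choose φ hφ hφroot hφα using hex
  refine ⟨φ, hφ, ⟨α, hα, hφα⟩, ?_⟩
  refine eq_nodal_of_monic (fun i j hij => hα ?_) (hH.monic.map _) ?_ fun i _ => hφroot i
  · apply MvPolynomial.C_injective (Fin n) K
    rw [← hφα, ← hφα, hij]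
  · rw [hH.monic.natDegree_map, hFd, Finset.card_univ, Fintype.card_fin]

lemma exists_finset_forall_eval_eq_zero {f : PolyXY n K} (hf : Irreducible f)
    (hH : HypothesisH f) (hd : f.totalDegree = e + 1)
    {φ : Fin (e + 1) → (MvPolynomial (Fin n) K)⟦X⟧} {α : Fin (e + 1) → K}
    (hα : Function.Injective α)
    (hφα : ∀ i, PowerSeries.constantCoeff (φ i) = MvPolynomial.C (α i))
    (hFφ : (MvPolynomial.optionEquivLeft K (Fin n) f).map generalLine =
      Lagrange.nodal Finset.univ φ) {a : Fin n → K} (ha : BertinianBad f a) :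
    ∃ T : Finset (Fin (e + 1)), 0 ∈ T ∧ T ≠ Finset.univ ∧
      (∀ j k, e < j + k →
        MvPolynomial.eval a (PowerSeries.coeff k ((logDerivY φ T).coeff j)) = 0) ∧
      ∀ j k, e + 1 < j + k →
        MvPolynomial.eval a (PowerSeries.coeff k ((logDerivX φ T).coeff j)) = 0 := by
  have hmap := map_restrict f a
  have hw := weightLE_map_generalLine hd (hH.degree_y.trans hd)
  rw [hFφ, map_nodal] at hmap
  have hFd : (MvPolynomial.optionEquivLeft K (Fin n) f).natDegree = e + 1 := by
    rw [MvPolynomial.natDegree_optionEquivLeft, hH.degree_y, hd]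
  have hψ : Function.Injective fun i => PowerSeries.map (MvPolynomial.eval a) (φ i) := by
    intro i j hij
    apply hα
    have h := congr_arg (PowerSeries.coeff 0) hij
    simp only [PowerSeries.coeff_map, PowerSeries.coeff_zero_eq_constantCoeff_apply, hφα,
      MvPolynomial.eval_C] at h
    exact h
  obtain ⟨T, h0, hT, hY, hX⟩ := exists_finset_of_not_irreducible (p := restrict f a)
    (by rw [restrict_eq_map]; exact hH.monic.map _)
    (by rw [restrict_eq_map, hH.monic.natDegree_map, hFd])
    (fun j k hjk => by
      rw [map_restrict, coeff_map, PowerSeries.coeff_map, hw j k hjk, map_zero])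
    (not_irreducible_restrict_of_bad hf ha) hψ hmap
  exact ⟨T, h0, hT, fun j k h => by rw [← coeff_logDerivY_map]; exact hY j k h,
    fun j k h => by rw [← coeff_logDerivX_map]; exact hX j k h⟩

lemma natCast_ne_zero_of_ringChar {N : ℕ} (h : ringChar K = 0 ∨ N < ringChar K) {k : ℕ}
    (hk : 0 < k) (hkN : k ≤ N) : (k : K) ≠ 0 := by
  intro hk0
  have hdvd := (ringChar.spec K k).1 hk0
  rcases h with h | h
  · rw [h, zero_dvd_iff] at hdvd
    omega
  · have := Nat.le_of_dvd hk hdvd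
    omega

end Cover

end BertinianCover


/-! ### The main theorem. -/

open BertinianCover in
theorem lemma4p3 {K : Type*} [Field K] [IsAlgClosed K] (n d : ℕ) (hd : 1 ≤ d)
    (hchar : ringChar K = 0 ∨ d * (d - 1) < ringChar K)
    (f : BertinianCover.PolyXY n K) (hirr : Irreducible f) (hdeg : f.totalDegree = d)
    (hH : BertinianCover.HypothesisH f) :
    ∃ Q : Fin (2 ^ (d - 1) - 1) → MvPolynomial (Fin n) K,
      (∀ i, Q i ≠ 0 ∧ (Q i).totalDegree ≤ 2 * d - 1) ∧
        ∀ a : Fin n → K, BertinianCover.BertinianBad f a → ∃ i, MvPolynomial.eval a (Q i) = 0 := by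
  obtain ⟨e, rfl⟩ : ∃ e, d = e + 1 := ⟨d - 1, by omega⟩
  rw [Nat.add_sub_cancel] at *
  obtain ⟨φ, hφ, ⟨α, hα, hφα⟩, hFφ⟩ := exists_factorization hH hdeg
  have hinj : Function.Injective fun i => PowerSeries.constantCoeff (φ i) := fun i j hij => hα (by
    apply MvPolynomial.C_injective (Fin n) K
    rw [← hφα, ← hφα]
    exact hij)
  have hcert (T : Finset (Fin (e + 1))) (hT : T ≠ Finset.univ) (h0 : 0 ∈ T) :=
    exists_coeff_ne_zero hH.monic
      ((MulEquiv.irreducible_iff (MvPolynomial.optionEquivLeft K (Fin n))).2 hirr)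
      (by rw [MvPolynomial.natDegree_optionEquivLeft, hH.degree_y, hdeg])
      (weightLE_map_generalLine hdeg (hH.degree_y.trans hdeg)) hφ hinj hFφ
      (fun k h0 hk => natCast_ne_zero_of_ringChar hchar h0 hk) hT ⟨0, h0⟩
  -- Deleting `0` turns the proper subsets of `Fin (e + 1)` containing `0` into the proper subsets
  -- of `Fin e`, of which there are `2 ^ e - 1`.
  let ι := {U : Finset (Fin e) // U ≠ Finset.univ}
  have hι : Fintype.card ι = 2 ^ e - 1 := by
    rw [Fintype.card_subtype_compl, Fintype.card_finset, Fintype.card_fin,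
      Fintype.card_subtype_eq]
  let E : Fin (2 ^ e - 1) ≃ ι := (Fintype.equivFinOfCardEq hι).symm
  let lift : Finset (Fin e) → Finset (Fin (e + 1)) := fun U =>
    insert 0 (U.map (Fin.succEmb e))
  have hsucc (U : Finset (Fin e)) (i : Fin e) : i.succ ∈ lift U ↔ i ∈ U := by
    simp [lift, Fin.succ_ne_zero]
  have hlift (U : ι) : lift U ≠ Finset.univ := fun h =>
    U.2 (Finset.eq_univ_iff_forall.2 fun i => (hsucc U i).1 (h ▸ Finset.mem_univ _))
  choose Q hQ0 hQdeg hQ using fun U : ι =>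
    hcert (lift U) (hlift U) (Finset.mem_insert_self _ _)
  refine ⟨fun i => Q (E i), fun i => ⟨hQ0 _, (hQdeg _).trans (by omega)⟩, fun a ha => ?_⟩
  obtain ⟨T, h0, hT, hY, hX⟩ :=
    exists_finset_forall_eval_eq_zero hirr hH hdeg hα hφα hFφ ha
  let U : Finset (Fin e) := {i | i.succ ∈ T}
  have hUT : lift U = T := by
    ext i
    cases i using Fin.cases with
    | zero => simp [lift, h0]
    | succ i => rw [hsucc]; simp [U]
  have hU : U ≠ Finset.univ := by
    intro h
    apply hT
    rw [← hUT, h, Finset.eq_univ_iff_forall]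
    intro i
    cases i using Fin.cases with
    | zero => simp [lift]
    | succ i => simp [hsucc]
  refine ⟨E.symm ⟨U, hU⟩, ?_⟩
  simp only [E.apply_symm_apply]
  rcases hQ ⟨U, hU⟩ with ⟨j, k, hjk, h⟩ | ⟨j, k, hjk, h⟩
  · rw [h, hUT]; exact hY j k hjk
  · rw [h, hUT]; exact hX j k hjk
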